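/- Let $d\ge 1$. A set $\mathcal U\subset\mathbb R^d$ is a \emph{universal convex covering} of $\mathbb R^d$ if there is $v>0$ such that $\mathcal C+\mathcal U=\mathbb R^d$ for every convex set $\mathcal C\subset\mathbb R^d$ of volume strictly greater than $v$. Let $\mathcal G_0$ be the set of positive (weakly) increasing functions $f$ defined on an interval $[M(f),+\infty[$, where $M(f)\in\mathbb R$ may depend on $f$. For $f,g\in\mathcal G_0$ write $f\preceq g$ if there is $t\ge 1$ such that $f(x)\le g(tx)$ for all $x\ge t$, and $f\sim g$ if there is $t\ge 1$ such that $g(x)\le f(tx)\le g(t^2x)$ for all $x\ge t$ (in both cases with $t$ so large that all these values are defined). The quotient $\mathcal G=\mathcal G_0/{\sim}$, partially ordered by the relation induced by $\preceq$, is the set of \emph{growth classes}. For $a>0$ let $\ell_a(x)=x^a$. A growth class $f$ is \emph{polynomially bounded} if $f\preceq\ell_a$ for some $a>0$; in this case it has \emph{critical exponent} $a>0$ if $\ell_b\preceq f\preceq\ell_c$ for all positive $b,c$ with $b<a<c$. The growth class of a non-empty set $\mathcal S\subset\mathbb R^d$ without accumulation points is the class of the function $r\mapsto\sharp\{x\in\mathcal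 S : \|x\|\le r\}$, where $\|\cdot\|$ is the Euclidean norm. A set $\mathcal S\subset\mathbb R^d$ is \emph{nearly uniform} if it is non-empty, has no accumulation points, and its growth class is polynomially bounded with critical exponent $d$. \textbf{Theorem.} In every dimension $d\ge 1$ there exists a nearly uniform universal convex covering of $\mathbb R^d$. -/

import Mathlib

open scoped Pointwise

namespace ConvexCovering

/-- `U ⊆ ℝ^d` is a `v`-universal convex covering: `C + U = ℝ^d` for every convex `C ⊆ ℝ^d` of
(Lebesgue) volume strictly greater than `v`, infinite volume included. -/
def IsUniversalConvexCoveringWith {d : ℕ} (v : ℝ) (U : Set (EuclideanSpace ℝ (Fin d))) : Prop :=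
  ∀ C : Set (EuclideanSpace ℝ (Fin d)), Convex ℝ C →
    ENNReal.ofReal v < MeasureTheory.volume C → C + U = Set.univ

/-- `U ⊆ ℝ^d` is a universal convex covering: a `v`-universal one for some real `v > 0`. -/
def IsUniversalConvexCovering {d : ℕ} (U : Set (EuclideanSpace ℝ (Fin d))) : Prop :=
  ∃ v : ℝ, 0 < v ∧ IsUniversalConvexCoveringWith v U

/-- A positive (weakly) increasing function on an interval `[start, ∞)`.
The values of `toFun` to the left of `start` are irrelevant. -/
structure GrowthFunction where
  /-- the underlying function -/
  toFun : ℝ → ℝ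
  /-- the left end of the interval of definition -/
  start : ℝ
  pos : ∀ x, start ≤ x → 0 < toFun x
  mono : MonotoneOn toFun (Set.Ici start)

namespace GrowthFunction

/-- `f ≼ g`: there is `t ≥ 1` with `f x ≤ g (t * x)` for all `x ≥ t`. The bounds on the two
starting points make sure that both functions are evaluated inside their intervals of definition
only; as `t` may always be enlarged, they are no restriction. -/
def Dominated (f g : GrowthFunction) : Prop :=
  ∃ t : ℝ, 1 ≤ t ∧ f.start ≤ t ∧ g.start ≤ t ∧ ∀ x, t ≤ x → f.toFun x ≤ g.toFun (t * x)

/-- `f ∼ g`: there is `t ≥ 1` with `g x ≤ f (t * x) ≤ g (t ^ 2 * x)` for all `x ≥ t`. -/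
def Equivalent (f g : GrowthFunction) : Prop :=
  ∃ t : ℝ, 1 ≤ t ∧ f.start ≤ t ∧ g.start ≤ t ∧
    ∀ x, t ≤ x → g.toFun x ≤ f.toFun (t * x) ∧ f.toFun (t * x) ≤ g.toFun (t ^ 2 * x)

theorem Dominated.refl (f : GrowthFunction) : f.Dominated f :=
  ⟨max 1 f.start, le_max_left _ _, le_max_right _ _, le_max_right _ _, fun x hx => by
    have h1 : (1 : ℝ) ≤ max 1 f.start := le_max_left _ _
    have h2 : f.start ≤ x := (le_max_right _ _).trans hx
    have h3 : x ≤ max 1 f.start * x := le_mul_of_one_le_left (by linarith) h1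
    exact f.mono h2 (h2.trans h3) h3⟩

theorem Dominated.trans {f g h : GrowthFunction} (hfg : f.Dominated g) (hgh : g.Dominated h) :
    f.Dominated h := by
  obtain ⟨s, hs, hfs, -, H⟩ := hfg
  obtain ⟨t, ht, -, hht, K⟩ := hgh
  have h1 : s ≤ t * s := le_mul_of_one_le_left (by linarith) ht
  have h2 : t ≤ t * s := le_mul_of_one_le_right (by linarith) hs
  refine ⟨t * s, by linarith, by linarith, by linarith, fun x hx => ?_⟩
  have h3 : x ≤ s * x := le_mul_of_one_le_left (by linarith) hs
  have := K (s * x) (by linarith)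
  rw [← mul_assoc] at this
  exact (H x (by linarith)).trans this

theorem equivalent_iff {f g : GrowthFunction} :
    f.Equivalent g ↔ f.Dominated g ∧ g.Dominated f := by
  constructor
  · rintro ⟨t, ht, hf, hg, H⟩
    refine ⟨?_, t, ht, hg, hf, fun x hx => (H x hx).1⟩
    have h1 : t ≤ t ^ 2 := by nlinarith
    refine ⟨t ^ 2, by linarith, by linarith, by linarith, fun x hx => ?_⟩
    have h0 : (0 : ℝ) < t := by linarith
    have h2 : t ≤ x / t := by rw [le_div_iff₀ h0]; nlinarith
    have h3 := (H (x / t) h2).2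
    have h4 : t * (x / t) = x := by field_simp
    have h5 : t ^ 2 * (x / t) = t * x := by field_simp
    rw [h4, h5] at h3
    have h6 : t * x ≤ t ^ 2 * x := mul_le_mul_of_nonneg_right h1 (by linarith)
    have h7 : g.start ≤ t * x := by nlinarith
    exact h3.trans (g.mono h7 (h7.trans h6) h6)
  · rintro ⟨⟨s, hs, hfs, hgs, H⟩, ⟨t, ht, -, -, K⟩⟩
    have h1 : s ≤ s * t := le_mul_of_one_le_right (by linarith) ht
    have h2 : t ≤ s * t := le_mul_of_one_le_left (by linarith) hs
    refine ⟨s * t, by linarith, by linarith, by linarith, fun x hx => ⟨?_, ?_⟩⟩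
    · have h3 : t * x ≤ s * t * x := mul_le_mul_of_nonneg_right h2 (by linarith)
      have h4 : x ≤ t * x := le_mul_of_one_le_left (by linarith) ht
      have h5 : f.start ≤ t * x := by linarith
      exact (K x (by linarith)).trans (f.mono h5 (h5.trans h3) h3)
    · have h3 : x ≤ s * t * x := le_mul_of_one_le_left (by linarith) (by linarith)
      have h4 : s * (s * t * x) ≤ (s * t) ^ 2 * x := by
        have := mul_le_mul_of_nonneg_right h1 (show (0 : ℝ) ≤ s * t * x by linarith)
        linarith
      have h5 : s * t * x ≤ s * (s * t * x) := le_mul_of_one_le_left (by linarith) hs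
      have h6 : g.start ≤ s * (s * t * x) := by linarith
      exact (H (s * t * x) (by linarith)).trans (g.mono h6 (h6.trans h4) h4)

instance instPreorder : Preorder GrowthFunction where
  le := Dominated
  le_refl := Dominated.refl
  le_trans _ _ _ := Dominated.trans

instance instSetoid : Setoid GrowthFunction where
  r := Equivalent
  iseqv :=
    { refl := fun f => equivalent_iff.2 ⟨Dominated.refl f, Dominated.refl f⟩
      symm := fun h => equivalent_iff.2 (equivalent_iff.1 h).symm
      trans := fun h k => equivalent_iff.2
        ⟨(equivalent_iff.1 h).1.trans (equivalent_iff.1 k).1,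
          (equivalent_iff.1 k).2.trans (equivalent_iff.1 h).2⟩ }

/-- The function `ℓ_a(x) = x ^ a`, for `a > 0`. -/
noncomputable def power (a : ℝ) (ha : 0 < a) : GrowthFunction where
  toFun x := x ^ a
  start := 1
  pos x hx := Real.rpow_pos_of_pos (by linarith) a
  mono x hx y _ hxy :=
    Real.rpow_le_rpow (by have : (1 : ℝ) ≤ x := hx; linarith) hxy ha.le

end GrowthFunction

/-- Growth classes: the quotient of the growth functions by `∼`. -/
def GrowthClass : Type := Quotient GrowthFunction.instSetoid

namespace GrowthClass

/-- The growth class of a growth function. -/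
def mk (f : GrowthFunction) : GrowthClass := Quotient.mk GrowthFunction.instSetoid f

/-- The partial order on growth classes induced by `≼`. -/
instance instPartialOrder : PartialOrder GrowthClass where
  le := Quotient.lift₂ (fun f g : GrowthFunction => f ≤ g) (by
    intro f g f' g' hf hg
    have hf' := GrowthFunction.equivalent_iff.1 hf
    have hg' := GrowthFunction.equivalent_iff.1 hg
    exact propext ⟨fun h => hf'.2.trans (GrowthFunction.Dominated.trans h hg'.1),
      fun h => hf'.1.trans (GrowthFunction.Dominated.trans h hg'.2)⟩)
  le_refl c := Quotient.inductionOn c fun f => GrowthFunction.Dominated.refl f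
  le_trans a b c := Quotient.inductionOn₃ a b c fun _ _ _ h k =>
    GrowthFunction.Dominated.trans h k
  le_antisymm a b := Quotient.inductionOn₂ a b fun _ _ h k =>
    Quotient.sound (GrowthFunction.equivalent_iff.2 ⟨h, k⟩)

theorem mk_le_mk {f g : GrowthFunction} : mk f ≤ mk g ↔ f.Dominated g := Iff.rfl

/-- The class of `ℓ_a`. -/
noncomputable def power (a : ℝ) (ha : 0 < a) : GrowthClass := mk (GrowthFunction.power a ha)

/-- `c ≼ ℓ_a` for some `a > 0`. -/
def PolynomiallyBounded (c : GrowthClass) : Prop :=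
  ∃ (a : ℝ) (ha : 0 < a), c ≤ power a ha

/-- A polynomially bounded class `c` has critical exponent `a > 0` if `ℓ_b ≼ c ≼ ℓ_e` whenever
`0 < b < a < e`, and critical exponent `0` if `c ≼ ℓ_b` for every `b > 0`. -/
def HasCriticalExponent (c : GrowthClass) (a : ℝ) : Prop :=
  c.PolynomiallyBounded ∧
    ((0 < a ∧ ∀ (b e : ℝ) (hb : 0 < b) (he : 0 < e), b < a → a < e →
        power b hb ≤ c ∧ c ≤ power e he) ∨
      (a = 0 ∧ ∀ (b : ℝ) (hb : 0 < b), c ≤ power b hb))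

end GrowthClass

/-- `S` has no accumulation points in `ℝ^d`. -/
def NoAccumulationPoints {d : ℕ} (S : Set (EuclideanSpace ℝ (Fin d))) : Prop :=
  ∀ x, ¬ AccPt x (Filter.principal S)

theorem NoAccumulationPoints.finite_inter_closedBall {d : ℕ}
    {S : Set (EuclideanSpace ℝ (Fin d))} (hS : NoAccumulationPoints S) (r : ℝ) :
    (S ∩ Metric.closedBall 0 r).Finite := by
  by_contra hinf
  obtain ⟨x, -, hx⟩ := Set.Infinite.exists_accPt_of_subset_isCompact (K := Metric.closedBall 0 r)
    hinf (isCompact_closedBall _ _) Set.inter_subset_right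
  exact hS x (hx.mono (Filter.principal_mono.2 Set.inter_subset_left))

/-- The growth function `r ↦ #{x ∈ S : ‖x‖ ≤ r}` of a non-empty set without accumulation points,
positive from the norm of some point of `S` on. -/
noncomputable def growthFunction {d : ℕ} (S : Set (EuclideanSpace ℝ (Fin d)))
    (hne : S.Nonempty) (hS : NoAccumulationPoints S) : GrowthFunction where
  toFun r := ((S ∩ Metric.closedBall 0 r).ncard : ℝ)
  start := ‖hne.some‖
  pos r hr := by
    have h : (S ∩ Metric.closedBall 0 r).Nonempty :=
      ⟨hne.some, hne.some_mem, by simpa using hr⟩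
    exact_mod_cast (Set.ncard_pos (hS.finite_inter_closedBall r)).2 h
  mono r _ s _ hrs := by
    have h : S ∩ Metric.closedBall 0 r ⊆ S ∩ Metric.closedBall 0 s :=
      Set.inter_subset_inter_right _ (Metric.closedBall_subset_closedBall hrs)
    exact Nat.cast_le.2 (Set.ncard_le_ncard h (hS.finite_inter_closedBall s))

/-- The growth class of a non-empty set without accumulation points. -/
noncomputable def growthClass {d : ℕ} (S : Set (EuclideanSpace ℝ (Fin d)))
    (hne : S.Nonempty) (hS : NoAccumulationPoints S) : GrowthClass :=
  GrowthClass.mk (growthFunction S hne hS)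

/-- `S ⊆ ℝ^d` is nearly uniform: it is non-empty, has no accumulation points, and its growth class
is polynomially bounded with critical exponent `d`. -/
def IsNearlyUniform {d : ℕ} (S : Set (EuclideanSpace ℝ (Fin d))) : Prop :=
  ∃ (hne : S.Nonempty) (hS : NoAccumulationPoints S),
    (growthClass S hne hS).PolynomiallyBounded ∧
      (growthClass S hne hS).HasCriticalExponent (d : ℝ)

end ConvexCovering

/-! Since `C + U` contains `y` exactly when `y - C` meets `U`, it suffices to find a set of the
right growth that meets every convex set of large volume.

At scale `2 ^ k` this is a finite problem. A large convex subset of the cube of half-edge `2 ^ k`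
contains a parallelepiped of comparable volume (`exists_box_subset`), which in turn contains one of
volume at least 1 whose data lie on a grid of size polynomial in `2 ^ k`
(`exists_rational_box_subset`). So only `exp (O(k + 1))` sets have to be hit, each filling at least
a fraction `1 / β` of the cube, where `β` is its volume. The greedy algorithm
(`exists_finset_hitting`) does this with `O(β * (k + 1))` points. The factor `k + 1` is logarithmic
in the radius and does not affect the critical exponent.

The hitting sets of all scales cannot simply be united, as their points could pile up near the
origin; only the points far out in their cube are kept. This costs nothing but a constant in the
volume: contracting a convex set towards one of its points of large norm moves it into the outer
shell (`exists_convex_subset_shell`). Finally the integer lattice is adjoined, which secures the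
lower bound on growth. -/

open MeasureTheory

namespace ConvexCovering

/-! ### Greedy hitting sets for finite families of large sets -/

open Classical in
-- Averaging: the number of sets `A i` containing `x` has integral at least `F.card` over `B`, so at
-- some point it reaches its mean, which is at least `F.card / β`.
theorem exists_card_le_mul_card_filter_mem {α ι : Type*} [MeasurableSpace α] (μ : Measure α)
    {B : Set α} (hB : MeasurableSet B) {β : ℝ} (hβ : 0 ≤ β) (hμB : μ B ≤ ENNReal.ofReal β)
    (A : ι → Set α) (F : Finset ι) (hF : F.Nonempty) (hA : ∀ i ∈ F, MeasurableSet (A i))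
    (hAB : ∀ i ∈ F, A i ⊆ B) (hvol : ∀ i ∈ F, 1 ≤ μ (A i)) :
    ∃ x, (F.card : ℝ) ≤ β * ({i ∈ F | x ∈ A i}.card : ℝ) := by
  set f : α → ENNReal := fun x => ∑ i ∈ F, (A i).indicator 1 x with hf
  have hfc : ∀ x, f x = ({i ∈ F | x ∈ A i}.card : ENNReal) := fun x => by
    simp [hf, Set.indicator_apply]
  have hint : ∫⁻ x in B, f x ∂μ = ∑ i ∈ F, μ (A i) := by
    rw [hf, lintegral_finsetSum' _ fun i hi =>
      (measurable_one.indicator (hA i hi)).aemeasurable]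
    refine Finset.sum_congr rfl fun i hi => ?_
    rw [lintegral_indicator_one (hA i hi), Measure.restrict_apply (hA i hi),
      Set.inter_eq_left.2 (hAB i hi)]
  obtain ⟨i₀, hi₀⟩ := hF
  have hμ0 : μ B ≠ 0 := fun h => by
    have h1 := (hvol i₀ hi₀).trans ((measure_mono (hAB i₀ hi₀)).trans h.le)
    simp at h1
  have hμt : μ B ≠ ⊤ := ne_top_of_le_ne_top ENNReal.ofReal_ne_top hμB
  have hit : ∫⁻ x in B, f x ∂μ ≠ ⊤ := by
    rw [hint]
    exact ENNReal.sum_ne_top.2 fun i hi => ne_top_of_le_ne_top hμt (measure_mono (hAB i hi))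
  obtain ⟨x, -, hx⟩ := exists_setLAverage_le hμ0 hB.nullMeasurableSet hit
  rw [setLAverage_eq, hint, ENNReal.div_le_iff hμ0 hμt, hfc] at hx
  have h1 : (F.card : ENNReal) ≤ ∑ i ∈ F, μ (A i) := by
    simpa using Finset.card_nsmul_le_sum F (fun i => μ (A i)) 1 hvol
  have h2 : (F.card : ℝ) ≤ β * ({i ∈ F | x ∈ A i}.card : ℝ) := by
    have h3 := h1.trans (hx.trans (mul_le_mul_right hμB _))
    rw [← ENNReal.ofReal_natCast, ← ENNReal.ofReal_natCast, ← ENNReal.ofReal_mul (by positivity),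
      ENNReal.ofReal_le_ofReal_iff (by positivity)] at h3
    linarith
  exact ⟨x, h2⟩

open Classical in
/-- The greedy algorithm: `n` well-chosen points leave only a fraction `(1 - 1 / β) ^ n` of the
sets unhit. -/
theorem exists_finset_card_filter_disjoint_le {α ι : Type*} [MeasurableSpace α] (μ : Measure α)
    {B : Set α} (hB : MeasurableSet B) {β : ℝ} (hβ : 1 ≤ β) (hμB : μ B ≤ ENNReal.ofReal β)
    (A : ι → Set α) (F : Finset ι) (hA : ∀ i ∈ F, MeasurableSet (A i))
    (hAB : ∀ i ∈ F, A i ⊆ B) (hvol : ∀ i ∈ F, 1 ≤ μ (A i)) (n : ℕ) :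
    ∃ N : Finset α, N.card ≤ n ∧
      ({i ∈ F | ∀ x ∈ N, x ∉ A i}.card : ℝ) ≤ F.card * (1 - 1 / β) ^ n := by
  have h0 : 0 ≤ 1 - 1 / β := by
    have : 1 / β ≤ 1 := by rw [div_le_one (by linarith)]; exact hβ
    linarith
  induction n with
  | zero => exact ⟨∅, by simp, by simp⟩
  | succ n ih =>
    obtain ⟨N, hN, hc⟩ := ih
    set F' : Finset ι := {i ∈ F | ∀ x ∈ N, x ∉ A i} with hF'
    rcases F'.eq_empty_or_nonempty with he | hne
    · refine ⟨N, by omega, ?_⟩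
      rw [← hF', he]
      simpa using mul_nonneg (Nat.cast_nonneg _) (pow_nonneg h0 _)
    · have hsub : ∀ i ∈ F', i ∈ F := fun i hi => (Finset.mem_filter.1 hi).1
      obtain ⟨x, hx⟩ := exists_card_le_mul_card_filter_mem μ hB (by linarith) hμB A F' hne
        (fun i hi => hA i (hsub i hi)) (fun i hi => hAB i (hsub i hi))
        (fun i hi => hvol i (hsub i hi))
      refine ⟨insert x N, (Finset.card_insert_le _ _).trans (by omega), ?_⟩
      have he : {i ∈ F | ∀ y ∈ insert x N, y ∉ A i} = {i ∈ F' | ¬ x ∈ A i} := by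
        ext i
        simp only [hF', Finset.mem_filter, Finset.mem_insert, forall_eq_or_imp]
        tauto
      rw [he]
      have h1 : ({i ∈ F' | x ∈ A i}.card : ℝ) + ({i ∈ F' | ¬ x ∈ A i}.card : ℝ) = F'.card := by
        exact_mod_cast Finset.card_filter_add_card_filter_not (s := F') (fun i => x ∈ A i)
      have h2 : (F'.card : ℝ) / β ≤ ({i ∈ F' | x ∈ A i}.card : ℝ) := by
        rw [div_le_iff₀ (by linarith)]; linarith
      calc ({i ∈ F' | ¬ x ∈ A i}.card : ℝ) ≤ F'.card * (1 - 1 / β) := by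
            rw [mul_sub, mul_one, mul_one_div]; linarith
        _ ≤ F.card * (1 - 1 / β) ^ n * (1 - 1 / β) := mul_le_mul_of_nonneg_right hc h0
        _ = F.card * (1 - 1 / β) ^ (n + 1) := by ring

/-- After more than `β * X` greedy steps the unhit sets number less than `exp X * exp (-X) = 1`,
hence there are none. -/
theorem exists_finset_hitting {α ι : Type*} [MeasurableSpace α] (μ : Measure α)
    {B : Set α} (hB : MeasurableSet B) {β : ℝ} (hβ : 1 ≤ β) (hμB : μ B ≤ ENNReal.ofReal β)
    (A : ι → Set α) (F : Finset ι) (hA : ∀ i ∈ F, MeasurableSet (A i))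
    (hAB : ∀ i ∈ F, A i ⊆ B) (hvol : ∀ i ∈ F, 1 ≤ μ (A i)) {X : ℝ} (hX : 0 ≤ X)
    (hFX : F.card ≤ Real.exp X) :
    ∃ N : Finset α, (N.card : ℝ) ≤ β * X + 2 ∧ ∀ i ∈ F, ∃ x ∈ N, x ∈ A i := by
  classical
  obtain ⟨N, hN, hc⟩ := exists_finset_card_filter_disjoint_le μ hB hβ hμB A F hA hAB hvol
    -- The extra step makes the final inequality strict.
    (⌈β * X⌉₊ + 1)
  have hβ0 : 0 < β := by linarith
  refine ⟨N, ?_, ?_⟩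
  · have h1 : (N.card : ℝ) ≤ ⌈β * X⌉₊ + 1 := by exact_mod_cast hN
    have h2 := Nat.ceil_lt_add_one (show 0 ≤ β * X by positivity)
    linarith
  · have h3 : (1 - 1 / β) ^ (⌈β * X⌉₊ + 1) < Real.exp (-X) := by
      have h4 : (1 - 1 / β) ≤ Real.exp (-(1 / β)) := by
        have := Real.add_one_le_exp (-(1 / β)); linarith
      have h0 : 0 ≤ 1 - 1 / β := by
        have : 1 / β ≤ 1 := by rw [div_le_one (by linarith)]; exact hβ
        linarith
      refine (pow_le_pow_left₀ h0 h4 _).trans_lt ?_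
      rw [← Real.exp_nat_mul, Real.exp_lt_exp]
      have h5 := Nat.le_ceil (β * X)
      have h6 : X < ((⌈β * X⌉₊ + 1 : ℕ) : ℝ) * (1 / β) := by
        rw [mul_one_div, lt_div_iff₀ hβ0]; push_cast; linarith
      linarith
    have h7 : (F.card : ℝ) * (1 - 1 / β) ^ (⌈β * X⌉₊ + 1) < 1 := by
      rcases F.eq_empty_or_nonempty with he | hne
      · simp [he]
      · have hp : (0 : ℝ) < F.card := by exact_mod_cast Finset.card_pos.2 hne
        calc _ < (F.card : ℝ) * Real.exp (-X) := by gcongr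
          _ ≤ Real.exp X * Real.exp (-X) := by gcongr
          _ = 1 := by rw [← Real.exp_add]; simp
    have h8 : {i ∈ F | ∀ x ∈ N, x ∉ A i}.card = 0 := by
      have := hc.trans_lt h7
      exact Nat.lt_one_iff.1 (by exact_mod_cast this)
    intro i hi
    by_contra! h
    rw [Finset.card_eq_zero, Finset.filter_eq_empty_iff] at h8
    exact h8 hi h

/-! ### Parallelepipeds inside convex sets -/

variable {d : ℕ}

theorem abs_det_le_of_abs_le {T : Matrix (Fin d) (Fin d) ℝ} {x : ℝ} (h : ∀ i j, |T i j| ≤ x) :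
    |T.det| ≤ d.factorial * x ^ d := by
  simpa using Matrix.det_le (abv := AbsoluteValue.abs) h

theorem volume_image_add_mulVec_closedBall (m : Fin d → ℝ) (T : Matrix (Fin d) (Fin d) ℝ) {r : ℝ}
    (hr : 0 ≤ r) :
    volume ((fun a => m + T.mulVec a) '' Metric.closedBall 0 r) =
      ENNReal.ofReal (|T.det| * (2 * r) ^ d) := by
  have h : (fun a => m + T.mulVec a) '' Metric.closedBall 0 r =
      (fun x => m + x) '' (Matrix.toLin' T '' Metric.closedBall 0 r) := by
    rw [Set.image_image]; rfl
  rw [h, Set.image_add_left, measure_preimage_add, Measure.addHaar_image_linearMap,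
    LinearMap.det_toLin', Real.volume_pi_closedBall _ hr, ← ENNReal.ofReal_mul (abs_nonneg _)]
  simp

/-- The parallelepiped with centre `m` and half-edges the columns of `T`. -/
def box (m : Fin d → ℝ) (T : Matrix (Fin d) (Fin d) ℝ) : Set (Fin d → ℝ) :=
  (fun a => m + T.mulVec a) '' Metric.closedBall 0 1

theorem isCompact_box (m : Fin d → ℝ) (T : Matrix (Fin d) (Fin d) ℝ) : IsCompact (box m T) :=
  (isCompact_closedBall _ _).image
    (continuous_const.add (Continuous.matrix_mulVec continuous_const continuous_id))

/-- A simplex in `C` with a vertex at `x₀` of almost maximal volume. -/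
theorem exists_abs_det_almost_max {C : Set (Fin d → ℝ)} {R : ℝ}
    (hCR : C ⊆ Metric.closedBall 0 R) {x₀ : Fin d → ℝ} (hx₀ : x₀ ∈ interior C) :
    ∃ T : Matrix (Fin d) (Fin d) ℝ, (∀ j, (x₀ + fun i => T i j) ∈ C) ∧ 0 < |T.det| ∧
      ∀ S : Matrix (Fin d) (Fin d) ℝ, (∀ j, (x₀ + fun i => S i j) ∈ C) →
        |S.det| ≤ 2 * |T.det| := by
  set D : Set ℝ := (fun T : Matrix (Fin d) (Fin d) ℝ => |T.det|) ''
    {T | ∀ j, (x₀ + fun i => T i j) ∈ C} with hD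
  have hb : BddAbove D := by
    refine ⟨d.factorial * (2 * R) ^ d, ?_⟩
    rintro _ ⟨T, hT, rfl⟩
    refine abs_det_le_of_abs_le fun i j => ?_
    have h1 := norm_le_pi_norm (x₀ + fun i => T i j) i
    have h2 := norm_le_pi_norm x₀ i
    have h3 := mem_closedBall_zero_iff.1 (hCR (hT j))
    have h4 := mem_closedBall_zero_iff.1 (hCR (interior_subset hx₀))
    simp only [Pi.add_apply, Real.norm_eq_abs, abs_le] at *
    constructor <;> linarith
  obtain ⟨ε, hε, hball⟩ := Metric.isOpen_iff.1 isOpen_interior x₀ hx₀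
  have hpos : ∃ y ∈ D, 0 < y := by
    -- A small simplex at `x₀` with edges along the axes shows that the supremum is positive.
    refine ⟨_, ⟨(ε / 2) • (1 : Matrix (Fin d) (Fin d) ℝ), fun j => ?_, rfl⟩, ?_⟩
    · refine interior_subset (hball ?_)
      rw [mem_ball_iff_norm, add_sub_cancel_left]
      refine (pi_norm_lt_iff hε).2 fun i => ?_
      simp only [Matrix.smul_apply, Matrix.one_apply, smul_eq_mul, mul_ite, mul_one, mul_zero]
      split_ifs <;> simp [abs_of_pos, hε]
    · simp only [Matrix.det_smul, Matrix.det_one, mul_one]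
      positivity
  obtain ⟨y, hyD, hy⟩ := hpos
  have hs : 0 < sSup D := hy.trans_le (le_csSup hb hyD)
  obtain ⟨_, ⟨T, hT, rfl⟩, hlt⟩ := exists_lt_of_lt_csSup ⟨y, hyD⟩ (half_lt_self hs)
  refine ⟨T, hT, by linarith, fun S hS => ?_⟩
  have := le_csSup hb ⟨S, hS, rfl⟩
  simp only at *
  linarith

/-- Cramer's rule: the `i`-th coordinate of `y - x₀` in the columns of `T` is a quotient by `T.det`,
whose numerator is the determinant of `T` with column `i` replaced by `y - x₀`. That matrix again
satisfies the condition in `hmax`, so the quotient is at most 2 in absolute value. -/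
theorem subset_image_of_abs_det_le {C : Set (Fin d → ℝ)} {x₀ : Fin d → ℝ}
    {T : Matrix (Fin d) (Fin d) ℝ} (hT : ∀ j, (x₀ + fun i => T i j) ∈ C) (hpos : 0 < |T.det|)
    (hmax : ∀ S : Matrix (Fin d) (Fin d) ℝ, (∀ j, (x₀ + fun i => S i j) ∈ C) →
      |S.det| ≤ 2 * |T.det|) :
    C ⊆ (fun a => x₀ + T.mulVec a) '' Metric.closedBall 0 2 := by
  intro y hy
  have hdet : T.det ≠ 0 := abs_pos.1 hpos
  refine ⟨T.det⁻¹ • T.cramer (y - x₀), ?_, ?_⟩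
  · rw [mem_closedBall_zero_iff]
    refine (pi_norm_le_iff_of_nonneg (by norm_num)).2 fun i => ?_
    rw [Pi.smul_apply, Matrix.cramer_apply, smul_eq_mul, Real.norm_eq_abs, abs_mul, abs_inv,
      inv_mul_le_iff₀ hpos, mul_comm]
    refine hmax _ fun j => ?_
    by_cases h : j = i
    · subst h
      simpa only [Matrix.updateCol_self, Pi.sub_apply, ← Pi.sub_def, add_sub_cancel] using hy
    · simpa [Matrix.updateCol_apply, h] using hT j
  · simp only [Matrix.mulVec_smul, Matrix.mulVec_cramer, smul_smul, inv_mul_cancel₀ hdet, one_smul]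
    abel

theorem add_mulVec_mem_of_sum_le_one {C : Set (Fin d → ℝ)} (hC : Convex ℝ C) {x₀ : Fin d → ℝ}
    (hx₀ : x₀ ∈ C) {T : Matrix (Fin d) (Fin d) ℝ} (hT : ∀ j, (x₀ + fun i => T i j) ∈ C)
    {a : Fin d → ℝ} (ha : ∀ j, 0 ≤ a j) (hsum : ∑ j, a j ≤ 1) : x₀ + T.mulVec a ∈ C := by
  -- The index `none` stands for the vertex `x₀`, which takes the remaining weight.
  have h := hC.sum_mem (t := Finset.univ) (w := fun o : Option (Fin d) => o.elim (1 - ∑ j, a j) a)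
    (z := fun o : Option (Fin d) => o.elim x₀ fun j => x₀ + fun i => T i j)
    (by rintro (_ | j) - <;> simp [ha, hsum]) (by simp [Fintype.sum_option])
    (by rintro (_ | j) - <;> simp [hx₀, hT])
  convert h using 1
  ext i
  simp only [Fintype.sum_option, Option.elim, Pi.add_apply, Pi.smul_apply, Finset.sum_apply,
    smul_eq_mul, mul_add, Finset.sum_add_distrib, ← Finset.sum_mul, Matrix.mulVec, dotProduct]
  simp only [mul_comm (T i _)]
  ring

/-- A bounded convex set contains a parallelepiped of comparable volume. -/
theorem exists_box_subset (hd : 1 ≤ d) {C : Set (Fin d → ℝ)} (hC : Convex ℝ C) {R : ℝ}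
    (hCR : C ⊆ Metric.closedBall 0 R) (hvol : volume C ≠ 0) :
    ∃ (m : Fin d → ℝ) (L : Matrix (Fin d) (Fin d) ℝ), box m L ⊆ C ∧
      volume C ≤ ENNReal.ofReal (|L.det| * (8 * d) ^ d) := by
  have hd0 : (0 : ℝ) < d := by exact_mod_cast hd
  have hint : (interior C).Nonempty := by
    -- A convex set without interior lies in its frontier, which is null.
    by_contra h
    rw [Set.not_nonempty_iff_eq_empty] at h
    refine hvol (measure_mono_null subset_closure ?_)
    rw [closure_eq_interior_union_frontier, h, Set.empty_union]
    exact hC.addHaar_frontier volume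
  obtain ⟨x₀, hx₀⟩ := hint
  obtain ⟨T, hT, hpos, hmax⟩ := exists_abs_det_almost_max hCR hx₀
  -- This is the box of coefficients in `[0, 1 / d]`, which lies in the simplex. As `C` lies in the
  -- box of coefficients in `[-2, 2]`, the edges differ by the factor `4 * d`, and `(8 * d) ^ d`
  -- includes the `2 ^ d` of the unit cube.
  refine ⟨x₀ + T.mulVec (fun _ => 1 / (2 * d : ℝ)), (1 / (2 * d) : ℝ) • T, ?_, ?_⟩
  · rintro _ ⟨a, ha, rfl⟩
    have ha' : ∀ i, |a i| ≤ 1 := fun i =>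
      (norm_le_pi_norm a i).trans (mem_closedBall_zero_iff.1 ha)
    have h := add_mulVec_mem_of_sum_le_one hC (interior_subset hx₀) hT
      (a := (fun _ => 1 / (2 * d : ℝ)) + (1 / (2 * d) : ℝ) • a) (fun j => ?_) ?_
    · simpa [Matrix.mulVec_add, Matrix.mulVec_smul, Matrix.smul_mulVec, add_assoc] using h
    · have h1 : 0 ≤ 1 / (2 * d : ℝ) * (1 + a j) :=
        mul_nonneg (by positivity) (by linarith [(abs_le.1 (ha' j)).1])
      simp only [Pi.add_apply, Pi.smul_apply, smul_eq_mul]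
      linarith
    · have h1 : ∀ j, 1 / (2 * d : ℝ) + 1 / (2 * d) * a j ≤ 1 / d := fun j => by
        have h2 : 1 / (2 * d : ℝ) * a j ≤ 1 / (2 * d) * 1 :=
          mul_le_mul_of_nonneg_left (abs_le.1 (ha' j)).2 (by positivity)
        have h3 : 1 / (2 * d : ℝ) + 1 / (2 * d) * 1 = 1 / d := by field_simp; norm_num
        linarith
      calc _ ≤ ∑ _j : Fin d, 1 / (d : ℝ) := Finset.sum_le_sum fun j _ => h1 j
        _ = 1 := by simp [hd0.ne']
  · refine (measure_mono (subset_image_of_abs_det_le hT hpos hmax)).trans ?_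
    rw [volume_image_add_mulVec_closedBall _ _ (by norm_num)]
    refine ENNReal.ofReal_le_ofReal (le_of_eq ?_)
    have h1 : (0 : ℝ) < 1 / (2 * d) := by positivity
    rw [Matrix.det_smul, abs_mul, abs_pow, abs_of_pos h1, Fintype.card_fin, mul_right_comm,
      ← mul_pow, mul_comm]
    congr 2
    field_simp
    norm_num

/-! ### Rounding parallelepipeds to a grid -/

theorem exists_le_abs_det_one_add (d : ℕ) : ∃ δ : ℝ, 0 < δ ∧
    ∀ E : Matrix (Fin d) (Fin d) ℝ, (∀ i j, |E i j| ≤ δ) → 1 / 2 ≤ |(1 + E).det| := by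
  have hcont : Continuous fun E : Fin d → Fin d → ℝ =>
      |((1 : Matrix (Fin d) (Fin d) ℝ) + Matrix.of E).det| :=
    (Continuous.matrix_det (continuous_const.add continuous_id)).abs
  have h1 := hcont.tendsto 0
  have h2 : |((1 : Matrix (Fin d) (Fin d) ℝ) + Matrix.of (0 : Fin d → Fin d → ℝ)).det| = 1 := by
    simp
  rw [h2] at h1
  obtain ⟨δ, hδ, h⟩ := Metric.eventually_nhds_iff.1 (h1.eventually (lt_mem_nhds one_half_lt_one))
  refine ⟨δ / 2, by positivity, fun E hE => (h (y := Matrix.of.symm E) ?_).le⟩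
  rw [dist_zero_right]
  refine lt_of_le_of_lt ?_ (half_lt_self hδ)
  exact (pi_norm_le_iff_of_nonneg (by positivity)).2 fun i =>
    (pi_norm_le_iff_of_nonneg (by positivity)).2 fun j => hE i j

/-- The entries of the inverse are cofactors divided by a determinant of absolute value at least 1.
This is what keeps the grid polynomial in `R`. -/
theorem abs_inv_apply_le {L : Matrix (Fin d) (Fin d) ℝ} {R : ℝ} (hR : 1 ≤ R)
    (hL : ∀ i j, |L i j| ≤ R) (hdet : 1 ≤ |L.det|) (i j : Fin d) :
    |L⁻¹ i j| ≤ d.factorial * R ^ d := by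
  rw [Matrix.inv_def, Matrix.smul_apply, Ring.inverse_eq_inv', smul_eq_mul, abs_mul, abs_inv,
    inv_mul_le_iff₀ (by linarith), Matrix.adjugate_apply]
  have h : |(L.updateRow j (Pi.single i 1)).det| ≤ d.factorial * R ^ d := by
    refine abs_det_le_of_abs_le fun k l => ?_
    rw [Matrix.updateRow_apply]
    split_ifs
    · rw [Pi.single_apply]
      split_ifs <;> simp <;> linarith
    · exact hL k l
  exact h.trans (le_mul_of_one_le_left (by positivity) hdet)

theorem abs_mulVec_le {A : Matrix (Fin d) (Fin d) ℝ} {x : Fin d → ℝ} {q s : ℝ} (hq : 0 ≤ q)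
    (hA : ∀ i j, |A i j| ≤ q) (hx : ∀ i, |x i| ≤ s) (i : Fin d) :
    |A.mulVec x i| ≤ d * (q * s) := by
  rw [Matrix.mulVec, dotProduct]
  refine (Finset.abs_sum_le_sum_abs _ _).trans ?_
  refine (Finset.sum_le_sum (g := fun _ => q * s) fun j _ => ?_).trans (by simp)
  rw [abs_mul]
  exact mul_le_mul (hA i j) (hx j) (abs_nonneg _) hq

theorem box_subset_closedBall_entries {m : Fin d → ℝ} {L : Matrix (Fin d) (Fin d) ℝ} {R : ℝ}
    (h : box m L ⊆ Metric.closedBall 0 R) :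
    (∀ i, |m i| ≤ R) ∧ ∀ i j, |L i j| ≤ R := by
  have key : ∀ a : Fin d → ℝ, ‖a‖ ≤ 1 → ∀ i, |m i + L.mulVec a i| ≤ R := fun a ha i =>
    (norm_le_pi_norm (m + L.mulVec a) i).trans
      (mem_closedBall_zero_iff.1 (h ⟨a, mem_closedBall_zero_iff.2 ha, rfl⟩))
  refine ⟨fun i => by simpa using key 0 (by simp) i, fun i j => ?_⟩
  have h1 := key (Pi.single j 1) (by rw [Pi.norm_single]; simp) i
  have h2 := key (-Pi.single j 1) (by rw [norm_neg, Pi.norm_single]; simp) i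
  rw [Matrix.mulVec_neg] at h2
  simp only [Matrix.mulVec_single_one, Pi.neg_apply, Matrix.col_apply, abs_le] at h1 h2 ⊢
  constructor <;> linarith

theorem abs_floor_div_sub_le {N : ℝ} (hN : 0 < N) (x : ℝ) : |(⌊N * x⌋ : ℝ) / N - x| ≤ 1 / N := by
  have h1 := Int.floor_le (N * x)
  have h2 := Int.lt_floor_add_one (N * x)
  have h3 : (⌊N * x⌋ : ℝ) / N - x = (⌊N * x⌋ - N * x) / N := by field_simp
  rw [h3, abs_div, abs_of_pos hN]
  gcongr
  rw [abs_le]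
  constructor <;> linarith

/-- A parallelepiped in a ball contains one with coordinates on a grid of polynomial size. -/
theorem exists_rational_box_subset (d : ℕ) : ∃ K : ℕ, 1 ≤ K ∧ ∀ R : ℕ, 1 ≤ R →
    ∀ (m : Fin d → ℝ) (L : Matrix (Fin d) (Fin d) ℝ), box m L ⊆ Metric.closedBall 0 R →
      2 ≤ |L.det| → ∃ (m' : Fin d → ℤ) (L' : Fin d → Fin d → ℤ),
        (∀ i, |m' i| ≤ 2 * (K * R ^ (d + 1))) ∧ (∀ i j, |L' i j| ≤ 2 * (K * R ^ (d + 1))) ∧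
        box (fun i => m' i / (K * R ^ d)) (.of fun i j => L' i j / (K * R ^ d)) ⊆ box m L ∧
        1 ≤ volume (box (fun i => (m' i : ℝ) / (K * R ^ d))
          (.of fun i j => (L' i j : ℝ) / (K * R ^ d))) := by
  obtain ⟨δ, hδ, hdelta⟩ := exists_le_abs_det_one_add d
  -- The second bound makes the rounding error at most `1 / 2` in the coordinates given by `L`, for
  -- containment; the third keeps the determinant large.
  obtain ⟨K, hK⟩ := exists_nat_ge (max (max 1 (2 * d * (d + 1) * d.factorial))
    (2 * d * d.factorial / δ) : ℝ)
  simp only [max_le_iff] at hK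
  obtain ⟨⟨hK1, hK2⟩, hK3⟩ := hK
  refine ⟨K, by exact_mod_cast hK1, fun R hR m L hbox hdet => ?_⟩
  have hR1 : (1 : ℝ) ≤ R := by exact_mod_cast hR
  obtain ⟨hm, hL⟩ := box_subset_closedBall_entries hbox
  set N : ℝ := K * R ^ d with hNdef
  have hRd : (1 : ℝ) ≤ R ^ d := one_le_pow₀ hR1
  have hN1 : 1 ≤ N := one_le_mul_of_one_le_of_one_le hK1 hRd
  have hN0 : 0 < N := by linarith
  have hfl : ∀ x : ℝ, |x| ≤ R → |⌊N * x⌋| ≤ 2 * ((K : ℤ) * (R : ℤ) ^ (d + 1)) := fun x hx => by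
    have h1 := Int.floor_le (N * x)
    have h2 := Int.lt_floor_add_one (N * x)
    have h3 : |N * x| ≤ N * R := by
      rw [abs_mul, abs_of_pos hN0]; exact mul_le_mul_of_nonneg_left hx hN0.le
    have h4 : 1 ≤ N * R := one_le_mul_of_one_le_of_one_le hN1 hR1
    have h5 : |(⌊N * x⌋ : ℝ)| ≤ 2 * ((K : ℝ) * (R : ℝ) ^ (d + 1)) := by
      rw [show (K : ℝ) * (R : ℝ) ^ (d + 1) = N * R by rw [hNdef]; ring]
      rw [abs_le] at h3 ⊢
      constructor <;> linarith
    exact_mod_cast h5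
  have hhalf : ∀ i j, |L i j / 2| ≤ R := fun i j => by
    rw [abs_div, abs_two]; linarith [hL i j, abs_nonneg (L i j)]
  -- The edges are halved before rounding, which leaves room for the error.
  refine ⟨fun i => ⌊N * m i⌋, fun i j => ⌊N * (L i j / 2)⌋, fun i => hfl _ (hm i),
    fun i j => hfl _ (hhalf i j), ?_, ?_⟩
  all_goals
    set e : Fin d → ℝ := fun i => (⌊N * m i⌋ : ℝ) / N - m i with he
    set E : Matrix (Fin d) (Fin d) ℝ :=
      .of fun i j => (⌊N * (L i j / 2)⌋ : ℝ) / N - L i j / 2 with hE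
    have hm' : (fun i => (⌊N * m i⌋ : ℝ) / N) = m + e := by ext i; simp [he]
    have hL' : (.of fun i j => (⌊N * (L i j / 2)⌋ : ℝ) / N : Matrix (Fin d) (Fin d) ℝ) =
        (1 / 2 : ℝ) • L + E := by
      ext i j
      simp only [hE, Matrix.of_apply, Matrix.add_apply, Matrix.smul_apply, smul_eq_mul]
      ring
    have hEle : ∀ i j, |E i j| ≤ 1 / N := fun i j => abs_floor_div_sub_le hN0 _
    have hele : ∀ i, |e i| ≤ 1 / N := fun i => abs_floor_div_sub_le hN0 _
    have hLu : IsUnit L.det := isUnit_iff_ne_zero.2 (abs_pos.1 (by linarith))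
    have hLL : L * L⁻¹ = 1 := Matrix.mul_nonsing_inv L hLu
    have hinv := abs_inv_apply_le hR1 hL (by linarith : 1 ≤ |L.det|)
    have hq0 : (0 : ℝ) ≤ d.factorial * R ^ d := by positivity
    rw [hL']
  · rw [hm']
    rintro _ ⟨a, ha, rfl⟩
    have ha' : ∀ i, |a i| ≤ 1 := fun i =>
      (norm_le_pi_norm a i).trans (mem_closedBall_zero_iff.1 ha)
    refine ⟨(1 / 2 : ℝ) • a + L⁻¹.mulVec (e + E.mulVec a), ?_, ?_⟩
    · rw [mem_closedBall_zero_iff]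
      refine (pi_norm_le_iff_of_nonneg zero_le_one).2 fun i => ?_
      have h1 : ∀ i, |(e + E.mulVec a) i| ≤ (d + 1) / N := fun i => by
        have h2 := abs_mulVec_le (by positivity) hEle ha' i
        calc |(e + E.mulVec a) i| ≤ |e i| + |E.mulVec a i| := abs_add_le _ _
          _ ≤ 1 / N + d * (1 / N * 1) := add_le_add (hele i) h2
          _ = (d + 1) / N := by ring
      have h3 := abs_mulVec_le hq0 hinv h1 i
      have h4 : (d : ℝ) * (d.factorial * R ^ d * ((d + 1) / N)) ≤ 1 / 2 := by
        rw [show (d : ℝ) * (d.factorial * R ^ d * ((d + 1) / N)) =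
          (2 * d * (d + 1) * d.factorial) * R ^ d / (2 * N) by field_simp,
          div_le_div_iff₀ (by positivity) (by norm_num), hNdef]
        have := mul_le_mul_of_nonneg_right hK2 (by linarith : (0 : ℝ) ≤ R ^ d)
        linarith
      have h5 := ha' i
      simp only [Pi.add_apply, Pi.smul_apply, smul_eq_mul, Real.norm_eq_abs]
      refine (abs_add_le _ _).trans ?_
      rw [abs_mul, abs_of_pos (by norm_num : (0 : ℝ) < 1 / 2)]
      linarith
    · simp only [Matrix.mulVec_add, Matrix.mulVec_smul, Matrix.mulVec_mulVec, ← Matrix.mul_assoc,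
        hLL, Matrix.one_mul, Matrix.one_mulVec, Matrix.add_mulVec, Matrix.smul_mulVec]
      abel
  · rw [box, volume_image_add_mulVec_closedBall _ _ zero_le_one, ENNReal.one_le_ofReal]
    -- The factor `(1 / 2) ^ d` cancels the volume `2 ^ d` of the unit cube, leaving `|L.det|` times
    -- a determinant of absolute value at least `1 / 2`.
    have h1 : (1 / 2 : ℝ) • L + E = (1 / 2 : ℝ) • (L * (1 + (2 : ℝ) • (L⁻¹ * E))) := by
      rw [mul_add, mul_one, Matrix.mul_smul, ← mul_assoc, hLL, one_mul, smul_add, smul_smul]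
      norm_num
    have h2 : ∀ i j, |((2 : ℝ) • (L⁻¹ * E)) i j| ≤ δ := fun i j => by
      have h3 := abs_mulVec_le hq0 hinv (x := fun k => E k j) (fun k => hEle k j) i
      have h4 : 2 * ((d : ℝ) * (d.factorial * R ^ d * (1 / N))) ≤ δ := by
        rw [show 2 * ((d : ℝ) * (d.factorial * R ^ d * (1 / N))) =
          (2 * d * d.factorial) * R ^ d / N by ring, div_le_iff₀ hN0, hNdef]
        rw [div_le_iff₀ hδ] at hK3
        have := mul_le_mul_of_nonneg_right hK3 (by linarith : (0 : ℝ) ≤ R ^ d)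
        linarith
      rw [Matrix.smul_apply, smul_eq_mul, abs_mul, abs_two]
      have h5 : (L⁻¹ * E) i j = L⁻¹.mulVec (fun k => E k j) i := by
        rw [Matrix.mul_apply]; rfl
      rw [h5]
      linarith
    have h6 := hdelta _ h2
    rw [h1, Matrix.det_smul, Matrix.det_mul, abs_mul, abs_mul, Fintype.card_fin, mul_one,
      abs_of_pos (by positivity : (0 : ℝ) < (1 / 2) ^ d), mul_comm, ← mul_assoc, ← mul_pow]
    norm_num
    nlinarith [abs_nonneg L.det]

/-! ### Hitting convex sets at one scale -/

theorem card_Icc_neg_le {M : ℕ} (hM : 1 ≤ M) :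
    (Finset.Icc (-(M : ℤ)) M).card ≤ 3 * M := by
  rw [Int.card_Icc]; omega

/-- For each `k` there are at most `A * (k + 1) * (2 ^ k) ^ d` points that meet every large convex
subset of the cube of half-edge `2 ^ k`. -/
theorem exists_finset_hitting_convex (hd : 1 ≤ d) : ∃ A v : ℝ, 0 < A ∧ 0 < v ∧ ∀ k : ℕ,
    ∃ N : Finset (Fin d → ℝ), (N.card : ℝ) ≤ A * (k + 1) * ((2 : ℝ) ^ k) ^ d ∧
      ∀ C : Set (Fin d → ℝ), Convex ℝ C → C ⊆ Metric.closedBall 0 (2 ^ k) →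
        ENNReal.ofReal v < volume C → ∃ x ∈ N, x ∈ C := by
  classical
  obtain ⟨K, hK1, hK⟩ := exists_rational_box_subset d
  set D : ℝ := ((d + d * d : ℕ) : ℝ) * (6 * K + (d + 1)) with hDdef
  have hd0 : (0 : ℝ) < d := by exact_mod_cast hd
  have hD0 : 0 ≤ D := by positivity
  -- The volume bound is chosen so that `exists_box_subset` yields `2 ≤ |L.det|`.
  refine ⟨2 ^ d * D + 2, 2 * (8 * d) ^ d, by positivity, by positivity, fun k => ?_⟩
  set M : ℕ := 2 * (K * (2 ^ k) ^ (d + 1)) with hM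
  have hM1 : 1 ≤ M := by
    have : 0 < K * (2 ^ k) ^ (d + 1) := by positivity
    omega
  set β : ℝ := 2 ^ d * (2 ^ k) ^ d with hβdef
  have hβ1 : 1 ≤ β :=
    one_le_mul_of_one_le_of_one_le (one_le_pow₀ one_le_two) (one_le_pow₀ (one_le_pow₀ one_le_two))
  set I : Finset ℤ := Finset.Icc (-(M : ℤ)) M
  set G : (Fin d → ℤ) × (Fin d → Fin d → ℤ) → Set (Fin d → ℝ) := fun p =>
    box (fun i => (p.1 i : ℝ) / (K * ((2 ^ k : ℕ) : ℝ) ^ d))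
      (.of fun i j => (p.2 i j : ℝ) / (K * ((2 ^ k : ℕ) : ℝ) ^ d)) with hG
  set F₀ : Finset ((Fin d → ℤ) × (Fin d → Fin d → ℤ)) :=
    Fintype.piFinset (fun _ => I) ×ˢ Fintype.piFinset (fun _ => Fintype.piFinset fun _ => I)
  set F := {p ∈ F₀ | G p ⊆ Metric.closedBall 0 (2 ^ k) ∧ 1 ≤ volume (G p)}
  have hvolB : volume (Metric.closedBall (0 : Fin d → ℝ) (2 ^ k)) ≤ ENNReal.ofReal β := by
    rw [Real.volume_pi_closedBall _ (by positivity), Fintype.card_fin, hβdef, mul_pow]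
  -- A box has `d + d * d` integer parameters, each with at most `3 * M` values, and `log (3 * M)`
  -- is at most linear in `k`.
  have hcard : (F.card : ℝ) ≤ Real.exp (D * (k + 1)) := by
    have h1 : F.card ≤ (3 * M) ^ (d + d * d) := by
      refine (Finset.card_filter_le _ _).trans ?_
      simp only [F₀, Finset.card_product, Fintype.card_piFinset_const, ← pow_mul, ← pow_add]
      exact Nat.pow_le_pow_left (card_Icc_neg_le hM1) _
    have h2 : ((3 * M : ℕ) : ℝ) ≤ Real.exp ((6 * K + (d + 1)) * (k + 1)) := by
      have h3 : ((3 * M : ℕ) : ℝ) = 6 * K * 2 ^ (k * (d + 1)) := by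
        rw [hM]; push_cast; rw [← pow_mul]; ring
      have h4 : (6 * K : ℝ) ≤ Real.exp (6 * K) := by
        linarith [Real.add_one_le_exp (6 * K : ℝ)]
      have h5 : (2 : ℝ) ^ (k * (d + 1)) ≤ Real.exp ((k * (d + 1) : ℕ) * 1) := by
        rw [Real.exp_nat_mul]
        exact pow_le_pow_left₀ (by norm_num) (by linarith [Real.add_one_le_exp (1 : ℝ)]) _
      rw [h3]
      refine (mul_le_mul h4 h5 (by positivity) (by positivity)).trans ?_
      rw [← Real.exp_add, Real.exp_le_exp]
      push_cast
      have : (0 : ℝ) ≤ K * k := by positivity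
      nlinarith
    calc (F.card : ℝ) ≤ ((3 * M : ℕ) : ℝ) ^ (d + d * d) := by exact_mod_cast h1
      _ ≤ Real.exp ((6 * K + (d + 1)) * (k + 1)) ^ (d + d * d) := by gcongr
      _ = Real.exp (D * (k + 1)) := by rw [← Real.exp_nat_mul, hDdef]; ring_nf
  obtain ⟨N, hN, hhit⟩ := exists_finset_hitting volume
    (Metric.isClosed_closedBall (x := (0 : Fin d → ℝ)) (ε := 2 ^ k)).measurableSet hβ1 hvolB G F
    (fun p _ => (isCompact_box _ _).isClosed.measurableSet)
    (fun p hp => (Finset.mem_filter.1 hp).2.1) (fun p hp => (Finset.mem_filter.1 hp).2.2)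
    (X := D * (k + 1)) (by positivity) hcard
  refine ⟨N, hN.trans ?_, fun C hC hCR hvol => ?_⟩
  · have h1 : (1 : ℝ) ≤ (2 ^ k) ^ d := one_le_pow₀ (one_le_pow₀ one_le_two)
    have h2 : (1 : ℝ) ≤ (k + 1) * (2 ^ k) ^ d :=
      one_le_mul_of_one_le_of_one_le (by linarith [Nat.cast_nonneg (α := ℝ) k]) h1
    rw [hβdef]
    linarith
  · obtain ⟨m, L, hbox, hle⟩ := exists_box_subset hd hC hCR (pos_of_gt hvol).ne'
    have hdet : 2 ≤ |L.det| := by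
      have h1 := (ENNReal.ofReal_lt_ofReal_iff_of_nonneg (by positivity)).1 (hvol.trans_le hle)
      exact (lt_of_mul_lt_mul_right h1 (by positivity)).le
    obtain ⟨m', L', hm', hL', hsub, hv⟩ := hK (2 ^ k) Nat.one_le_two_pow m L
      (by push_cast; exact hbox.trans hCR) hdet
    have hMc : 2 * ((K : ℤ) * ((2 ^ k : ℕ) : ℤ) ^ (d + 1)) = M := by rw [hM]; push_cast; ring
    rw [hMc] at hm' hL'
    have hF : (m', L') ∈ F := by
      refine Finset.mem_filter.2 ⟨?_, (hsub.trans hbox).trans hCR, hv⟩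
      simp only [F₀, I, Finset.mem_product, Fintype.mem_piFinset, Finset.mem_Icc]
      exact ⟨fun i => abs_le.1 (hm' i), fun i j => abs_le.1 (hL' i j)⟩
    obtain ⟨x, hxN, hx⟩ := hhit _ hF
    exact ⟨x, hxN, hbox (hsub hx)⟩

/-! ### Gluing the scales along dyadic shells -/

/-- A bounded convex set contains a homothetic copy inside a dyadic shell. -/
theorem exists_convex_subset_shell {C : Set (Fin d → ℝ)} (hC : Convex ℝ C) {R : ℝ}
    (hCR : C ⊆ Metric.closedBall 0 R) {v : ℝ} (hv : 0 < v)
    (hvol : ENNReal.ofReal (8 ^ d * v) < volume C) :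
    ∃ (k : ℕ) (C' : Set (Fin d → ℝ)), Convex ℝ C' ∧ C' ⊆ C ∧ C' ⊆ Metric.closedBall 0 (2 ^ k) ∧
      ENNReal.ofReal v < volume C' ∧ ∀ x ∈ C', (2 : ℝ) ^ k ≤ 4 * ‖x‖ + 1 := by
  classical
  have hex : ∃ k : ℕ, C ⊆ Metric.closedBall 0 (2 ^ k) := by
    obtain ⟨k, hk⟩ := pow_unbounded_of_one_lt R one_lt_two
    exact ⟨k, hCR.trans (Metric.closedBall_subset_closedBall hk.le)⟩
  have hk := Nat.find_spec hex
  have hmin := @Nat.find_min _ _ hex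
  generalize Nat.find hex = k at hk hmin
  have h8 : v ≤ 8 ^ d * v := le_mul_of_one_le_left hv.le (one_le_pow₀ (by norm_num))
  -- The summand 1 in the shell condition makes it void for `k = 0`.
  rcases k with _ | k
  · refine ⟨0, C, hC, subset_rfl, hk, (ENNReal.ofReal_le_ofReal h8).trans_lt hvol, fun x _ => ?_⟩
    norm_num
  · obtain ⟨x, hx, hxk⟩ := Set.not_subset.1 (hmin (Nat.lt_succ_self k))
    rw [mem_closedBall_zero_iff, not_le] at hxk
    -- By minimality some `x` in `C` has norm above `2 ^ k`, while `C` has radius at most `2 ^ (k +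
    -- 1)`. Contracting by `1 / 8` towards `x` moves points by at most `2 ^ (k + 1) / 4` away from
    -- `x`, so their norms stay above `2 ^ (k + 1) / 4`.
    have hsub : AffineMap.homothety x (1 / 8 : ℝ) '' C ⊆ C := by
      rintro _ ⟨c, hc, rfl⟩
      rw [AffineMap.homothety_eq_lineMap]
      exact hC.lineMap_mem hx hc ⟨by norm_num, by norm_num⟩
    refine ⟨k + 1, AffineMap.homothety x (1 / 8 : ℝ) '' C, hC.affine_image _, hsub,
      hsub.trans hk, ?_, ?_⟩
    · rw [Measure.addHaar_image_homothety, Module.finrank_fin_fun]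
      have h1 : (0 : ℝ) < (1 / 8) ^ d := by positivity
      rw [abs_of_pos h1]
      calc ENNReal.ofReal v = ENNReal.ofReal ((1 / 8) ^ d) * ENNReal.ofReal (8 ^ d * v) := by
            rw [← ENNReal.ofReal_mul h1.le, ← mul_assoc, ← mul_pow]; norm_num
        _ < ENNReal.ofReal ((1 / 8) ^ d) * volume C :=
            ENNReal.mul_lt_mul_right (by simp) ENNReal.ofReal_ne_top hvol
    · rintro _ ⟨c, hc, rfl⟩
      have h1 := mem_closedBall_zero_iff.1 (hk hc)
      have h2 := mem_closedBall_zero_iff.1 (hk hx)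
      have h3 : ‖x‖ ≤ ‖AffineMap.homothety x (1 / 8 : ℝ) c‖ + (1 / 8) * (‖x‖ + ‖c‖) := by
        have h4 : x = AffineMap.homothety x (1 / 8 : ℝ) c + (1 / 8 : ℝ) • (x - c) := by
          simp only [AffineMap.homothety_apply, vsub_eq_sub, vadd_eq_add]
          module
        calc ‖x‖ = ‖AffineMap.homothety x (1 / 8 : ℝ) c + (1 / 8 : ℝ) • (x - c)‖ := by rw [← h4]
          _ ≤ ‖AffineMap.homothety x (1 / 8 : ℝ) c‖ + ‖(1 / 8 : ℝ) • (x - c)‖ := norm_add_le _ _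
          _ ≤ _ := by
            rw [norm_smul, Real.norm_of_nonneg (by norm_num)]
            gcongr
            exact norm_sub_le _ _
      rw [pow_succ] at h1 h2 ⊢
      linarith

/-- Continuity from below; it reduces unbounded sets, also of infinite volume, to bounded ones. -/
theorem exists_lt_volume_inter_closedBall {C : Set (Fin d → ℝ)} {a : ENNReal}
    (h : a < volume C) : ∃ R : ℝ, a < volume (C ∩ Metric.closedBall 0 R) := by
  have hmono : Monotone fun n : ℕ => C ∩ Metric.closedBall (0 : Fin d → ℝ) n := fun m n hmn =>
    Set.inter_subset_inter_right _ (Metric.closedBall_subset_closedBall (by exact_mod_cast hmn))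
  rw [← Set.inter_univ C, ← Metric.iUnion_closedBall_nat (0 : Fin d → ℝ), Set.inter_iUnion,
    hmono.measure_iUnion, lt_iSup_iff] at h
  obtain ⟨n, hn⟩ := h
  exact ⟨n, hn⟩

/-- The points of the finite sets `N k` outside of half of the cube they belong to. -/
def shellUnion (N : ℕ → Finset (Fin d → ℝ)) : Set (Fin d → ℝ) :=
  {x | ∃ k, x ∈ N k ∧ (2 : ℝ) ^ k ≤ 4 * ‖x‖ + 1}

theorem exists_shellUnion_hitting (hd : 1 ≤ d) : ∃ (A v : ℝ) (N : ℕ → Finset (Fin d → ℝ)),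
    0 < A ∧ 0 < v ∧ (∀ k, ((N k).card : ℝ) ≤ A * (k + 1) * ((2 : ℝ) ^ k) ^ d) ∧
      ∀ C : Set (Fin d → ℝ), Convex ℝ C → ENNReal.ofReal v < volume C →
        (C ∩ shellUnion N).Nonempty := by
  obtain ⟨A, v, hA, hv, h⟩ := exists_finset_hitting_convex hd
  choose N hN hhit using h
  refine ⟨A, 8 ^ d * v, N, hA, by positivity, hN, fun C hC hvol => ?_⟩
  obtain ⟨R, hR⟩ := exists_lt_volume_inter_closedBall hvol
  obtain ⟨k, C', hC', hsub, hball, hvol', hnorm⟩ := exists_convex_subset_shell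
    (hC.inter (convex_closedBall 0 R)) Set.inter_subset_right hv hR
  obtain ⟨x, hxN, hx⟩ := hhit k C' hC' hball hvol'
  exact ⟨x, (hsub hx).1, k, hxN, hnorm x hx⟩

/-! ### Growth of the union -/

/-- Only scales with `2 ^ k ≤ 4 * r + 1` reach the ball of radius `r`. Their number and the factor
`k + 1` are both logarithmic in `r`, and each is absorbed by a power `η`. -/
theorem exists_finset_shellUnion_inter_closedBall_subset {A : ℝ} {N : ℕ → Finset (Fin d → ℝ)}
    (hA : 0 < A) (hN : ∀ k, ((N k).card : ℝ) ≤ A * (k + 1) * ((2 : ℝ) ^ k) ^ d) {η : ℝ}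
    (hη : 0 < η) : ∃ c : ℝ, 0 ≤ c ∧ ∀ r : ℝ, 1 ≤ r → ∃ F : Finset (Fin d → ℝ),
      shellUnion N ∩ Metric.closedBall 0 r ⊆ F ∧ (F.card : ℝ) ≤ c * r ^ ((d : ℝ) + 2 * η) := by
  classical
  -- From `log x ≤ x ^ η / η` and `log 2 ≥ 1 / 2`, with the 1 accounting for the shift in `K + 1`.
  set B : ℝ := 2 / η + 1
  refine ⟨A * B ^ 2 * 5 ^ ((d : ℝ) + 2 * η), by positivity, fun r hr => ?_⟩
  set x : ℝ := 4 * r + 1 with hx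
  set K : ℕ := Nat.log 2 ⌊x⌋₊ with hK
  have hx0 : 0 < x := by linarith
  have hfl : ⌊x⌋₊ ≠ 0 := (Nat.floor_pos.2 (by linarith)).ne'
  have hKx : (2 : ℝ) ^ K ≤ x :=
    le_trans (by exact_mod_cast Nat.pow_log_le_self 2 hfl) (Nat.floor_le hx0.le)
  refine ⟨(Finset.range (K + 1)).biUnion N, ?_, ?_⟩
  · rintro y ⟨⟨k, hk, hky⟩, hyr⟩
    rw [mem_closedBall_zero_iff] at hyr
    refine Finset.mem_coe.2 (Finset.mem_biUnion.2 ⟨k, ?_, hk⟩)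
    rw [Finset.mem_range, Nat.lt_succ_iff]
    refine Nat.le_log_of_pow_le one_lt_two (Nat.le_floor ?_)
    push_cast
    linarith
  · have hKη : (K : ℝ) + 1 ≤ B * x ^ η := by
      have h1 : (K : ℝ) * Real.log 2 ≤ Real.log x := by
        rw [← Real.log_pow]
        exact Real.log_le_log (by positivity) hKx
      have h2 := Real.log_le_rpow_div hx0.le hη
      have h3 : (1 : ℝ) ≤ x ^ η := Real.one_le_rpow (by linarith) hη.le
      have h4 : (K : ℝ) * (1 / 2) ≤ K * Real.log 2 :=
        mul_le_mul_of_nonneg_left (by linarith [Real.log_two_gt_d9]) (Nat.cast_nonneg _)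
      have h5 : B * x ^ η = 2 * (x ^ η / η) + x ^ η := by simp only [B]; ring
      linarith
    have h1 : ∀ k ∈ Finset.range (K + 1), (N k).card ≤ A * (K + 1) * x ^ d := fun k hk => by
      have hkK : k ≤ K := Nat.lt_succ_iff.1 (Finset.mem_range.1 hk)
      refine (hN k).trans ?_
      have : (2 : ℝ) ^ k ≤ x := (pow_le_pow_right₀ one_le_two hkK).trans hKx
      gcongr
    calc (((Finset.range (K + 1)).biUnion N).card : ℝ)
        ≤ ∑ k ∈ Finset.range (K + 1), ((N k).card : ℝ) := by
          exact_mod_cast Finset.card_biUnion_le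
      _ ≤ ∑ _k ∈ Finset.range (K + 1), A * (K + 1) * x ^ d := Finset.sum_le_sum h1
      _ = A * (K + 1) ^ 2 * x ^ d := by
          rw [Finset.sum_const, Finset.card_range, nsmul_eq_mul]; push_cast; ring
      _ ≤ A * (B * x ^ η) ^ 2 * x ^ d := by gcongr
      _ = A * B ^ 2 * x ^ ((d : ℝ) + 2 * η) := by
          rw [Real.rpow_add hx0, Real.rpow_natCast, two_mul, Real.rpow_add hx0]; ring
      _ ≤ A * B ^ 2 * (5 * r) ^ ((d : ℝ) + 2 * η) := by
          gcongr
          linarith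
      _ = _ := by rw [Real.mul_rpow (by norm_num) (by linarith)]; ring

/-! ### Passage to Euclidean space and to growth classes -/

theorem isUniversalConvexCoveringWith_preimage_ofLp {v : ℝ} {S : Set (Fin d → ℝ)}
    (hS : ∀ C : Set (Fin d → ℝ), Convex ℝ C → ENNReal.ofReal v < volume C →
      (C ∩ S).Nonempty) :
    IsUniversalConvexCoveringWith v {x : EuclideanSpace ℝ (Fin d) | x.ofLp ∈ S} := by
  intro C hC hvol
  refine Set.eq_univ_of_forall fun y => ?_
  -- The reflected translate `y - C` is again convex of the same volume; a point of `S` in it writes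
  -- `y` as a sum.
  have hconv : Convex ℝ {z : Fin d → ℝ | y - WithLp.toLp 2 z ∈ C} := by
    intro a ha b hb s t hs ht hst
    have h := hC ha hb hs ht hst
    have he : s • (y - WithLp.toLp 2 a) + t • (y - WithLp.toLp 2 b) =
        y - WithLp.toLp 2 (s • a + t • b) := by
      rw [smul_sub, smul_sub, sub_add_sub_comm, ← add_smul, hst, one_smul]
      rfl
    rwa [he] at h
  have hv : volume {z : Fin d → ℝ | y - WithLp.toLp 2 z ∈ C} = volume C :=
    ((Measure.measurePreserving_sub_left volume y).comp
      (PiLp.volume_preserving_toLp (Fin d))).measure_preimage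
        (hC.nullMeasurableSet volume)
  obtain ⟨z, hz, hzS⟩ := hS _ hconv (hv ▸ hvol)
  exact ⟨_, hz, WithLp.toLp 2 z, hzS, sub_add_cancel _ _⟩

theorem noAccumulationPoints_of_finite {S : Set (EuclideanSpace ℝ (Fin d))}
    (h : ∀ r : ℝ, 1 ≤ r → (S ∩ Metric.closedBall 0 r).Finite) : NoAccumulationPoints S := by
  intro x hx
  have hfin := h (‖x‖ + 1) (by linarith [norm_nonneg x])
  have hnhds : Metric.closedBall (0 : EuclideanSpace ℝ (Fin d)) (‖x‖ + 1) ∈ nhds x :=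
    Filter.mem_of_superset (Metric.ball_mem_nhds x one_pos) fun y hy => by
      rw [mem_ball_iff_norm] at hy
      rw [mem_closedBall_zero_iff]
      linarith [norm_le_norm_add_norm_sub' y x]
  have hU : ((S ∩ Metric.closedBall 0 (‖x‖ + 1)) \ {x})ᶜ ∈ nhds x :=
    hfin.sdiff.isClosed.isOpen_compl.mem_nhds (by simp)
  obtain ⟨y, ⟨⟨hy1, hy2⟩, hyS⟩, hyx⟩ := accPt_iff_nhds.1 hx _ (Filter.inter_mem hnhds hU)
  exact hy2 ⟨⟨hyS, hy1⟩, hyx⟩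

/-- A set whose counting function is at least `(r / c) ^ d` and at most a multiple of `r ^ e` for
every `e > d` is nearly uniform. -/
theorem isNearlyUniform_of_ncard_bounds (hd : 1 ≤ d) {S : Set (EuclideanSpace ℝ (Fin d))}
    (hne : S.Nonempty) (hfin : ∀ r : ℝ, 1 ≤ r → (S ∩ Metric.closedBall 0 r).Finite)
    {c : ℝ} (hlow : ∀ r : ℝ, 1 ≤ r → r ^ d ≤ ((S ∩ Metric.closedBall 0 (c * r)).ncard : ℝ))
    (hup : ∀ e : ℝ, (d : ℝ) < e → ∃ c : ℝ, ∀ r : ℝ, 1 ≤ r →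
      ((S ∩ Metric.closedBall 0 r).ncard : ℝ) ≤ c * r ^ e) : IsNearlyUniform S := by
  have hS := noAccumulationPoints_of_finite hfin
  have hd1 : (1 : ℝ) ≤ d := by exact_mod_cast hd
  have hle : ∀ (e : ℝ) (he : 0 < e), (d : ℝ) < e →
      growthClass S hne hS ≤ GrowthClass.power e he := fun e he hde => by
    obtain ⟨a, ha⟩ := hup e hde
    refine GrowthClass.mk_le_mk.2 ⟨max (max 1 a) ‖hne.some‖, by simp, le_max_right _ _, by
      simp [GrowthFunction.power], fun x hx => ?_⟩
    set t := max (max 1 a) ‖hne.some‖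
    have ht1 : 1 ≤ t := by simp [t]
    have hta : a ≤ t := by simp [t]
    have hx1 : 1 ≤ x := ht1.trans hx
    have hx0 : 0 ≤ x ^ e := Real.rpow_nonneg (by linarith) e
    change ((S ∩ Metric.closedBall 0 x).ncard : ℝ) ≤ (t * x) ^ e
    rw [Real.mul_rpow (by linarith) (by linarith)]
    have h1 : t ^ (1 : ℝ) ≤ t ^ e := Real.rpow_le_rpow_of_exponent_le ht1 (by linarith)
    rw [Real.rpow_one] at h1
    exact (ha x hx1).trans (mul_le_mul_of_nonneg_right (hta.trans h1) hx0)
  have hge : ∀ (b : ℝ) (hb : 0 < b), b < d →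
      GrowthClass.power b hb ≤ growthClass S hne hS := fun b hb hbd => by
    refine GrowthClass.mk_le_mk.2 ⟨max (max 1 c) ‖hne.some‖, by simp, by
      simp [GrowthFunction.power], le_max_right _ _, fun x hx => ?_⟩
    set t := max (max 1 c) ‖hne.some‖
    have ht1 : 1 ≤ t := by simp [t]
    have htc : c ≤ t := by simp [t]
    have hx1 : 1 ≤ x := ht1.trans hx
    have htx : 1 ≤ t * x := one_le_mul_of_one_le_of_one_le ht1 hx1
    change x ^ b ≤ ((S ∩ Metric.closedBall 0 (t * x)).ncard : ℝ)
    have h1 : x ^ b ≤ x ^ (d : ℝ) := Real.rpow_le_rpow_of_exponent_le hx1 hbd.le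
    rw [Real.rpow_natCast] at h1
    refine (h1.trans (hlow x hx1)).trans (Nat.cast_le.2 (Set.ncard_le_ncard ?_ (hfin _ htx)))
    exact Set.inter_subset_inter_right _ (Metric.closedBall_subset_closedBall
      (mul_le_mul_of_nonneg_right htc (by linarith)))
  have hpoly : (growthClass S hne hS).PolynomiallyBounded :=
    ⟨d + 1, by linarith, hle _ (by linarith) (by linarith)⟩
  exact ⟨hne, hS, hpoly, hpoly, Or.inl ⟨by linarith, fun b e hb he hbd hde =>
    ⟨hge b hb hbd, hle e he hde⟩⟩⟩

theorem norm_ofLp_le (x : EuclideanSpace ℝ (Fin d)) : ‖x.ofLp‖ ≤ ‖x‖ :=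
  (pi_norm_le_iff_of_nonneg (norm_nonneg x)).2 fun i => PiLp.norm_apply_le x i

theorem norm_toLp_le_mul_norm (x : Fin d → ℝ) : ‖WithLp.toLp 2 x‖ ≤ d * ‖x‖ := by
  rw [EuclideanSpace.norm_eq]
  refine Real.sqrt_le_iff.2 ⟨by positivity, ?_⟩
  calc ∑ i, ‖x i‖ ^ 2 ≤ ∑ _i : Fin d, ‖x‖ ^ 2 :=
        Finset.sum_le_sum fun i _ => pow_le_pow_left₀ (norm_nonneg _) (norm_le_pi_norm x i) 2
    _ = d * ‖x‖ ^ 2 := by simp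
    _ ≤ (d * d : ℕ) * ‖x‖ ^ 2 := by gcongr; exact Nat.le_mul_self d
    _ = (d * ‖x‖) ^ 2 := by push_cast; ring

/-! ### Integer points, and the conclusion -/

/-- The points with integral coordinates in the cube of half-edge `n`. -/
noncomputable def integerCube (d n : ℕ) : Finset (Fin d → ℝ) :=
  (Fintype.piFinset fun _ : Fin d => Finset.Icc (-(n : ℤ)) n).map
    ⟨fun m i => (m i : ℝ), fun _ _ h => funext fun i => Int.cast_injective (congrFun h i)⟩

theorem card_integerCube (d n : ℕ) : (integerCube d n).card = (2 * n + 1) ^ d := by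
  rw [integerCube, Finset.card_map, Fintype.card_piFinset_const, Int.card_Icc]
  congr 1
  omega

theorem norm_le_of_mem_integerCube {n : ℕ} {x : Fin d → ℝ} (hx : x ∈ integerCube d n) :
    ‖x‖ ≤ n := by
  obtain ⟨m, hm, rfl⟩ := Finset.mem_map.1 hx
  refine (pi_norm_le_iff_of_nonneg (Nat.cast_nonneg n)).2 fun i => ?_
  have h := Finset.mem_Icc.1 (Fintype.mem_piFinset.1 hm i)
  have h1 : |(m i : ℝ)| ≤ n := by exact_mod_cast abs_le.2 h
  exact h1

theorem mem_integerCube_floor {m : Fin d → ℤ} {r : ℝ}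
    (h : ‖fun i => (m i : ℝ)‖ ≤ r) : (fun i => (m i : ℝ)) ∈ integerCube d ⌊r⌋₊ := by
  refine Finset.mem_map.2 ⟨m, Fintype.mem_piFinset.2 fun i => Finset.mem_Icc.2 (abs_le.1 ?_), rfl⟩
  have h1 : |(m i : ℝ)| ≤ r := (norm_le_pi_norm (fun i => (m i : ℝ)) i).trans h
  have h2 : (m i).natAbs ≤ ⌊r⌋₊ := Nat.le_floor (by rwa [Nat.cast_natAbs, Int.cast_abs])
  rw [Int.abs_eq_natAbs]
  exact_mod_cast h2

end ConvexCovering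

open ConvexCovering in
theorem mainTheorem5 (d : ℕ) (hd : 1 ≤ d) :
    ∃ U : Set (EuclideanSpace ℝ (Fin d)),
      ConvexCovering.IsUniversalConvexCovering U ∧ ConvexCovering.IsNearlyUniform U := by
  classical
  obtain ⟨A, v, N, hA, hv, hN, hhit⟩ := exists_shellUnion_hitting hd
  -- The hitting sets are bounded in size only from above; the lattice gives the lower bound and a
  -- point of the set.
  set Z : Set (Fin d → ℝ) := Set.range fun (m : Fin d → ℤ) i => (m i : ℝ) with hZ
  have hcover : ∀ η : ℝ, 0 < η → ∃ c : ℝ, ∀ r : ℝ, 1 ≤ r →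
      ∃ F : Finset (EuclideanSpace ℝ (Fin d)),
        {x : EuclideanSpace ℝ (Fin d) | x.ofLp ∈ shellUnion N ∪ Z} ∩ Metric.closedBall 0 r ⊆ F ∧
          (F.card : ℝ) ≤ c * r ^ ((d : ℝ) + 2 * η) := fun η hη => by
    obtain ⟨c, -, hc⟩ := exists_finset_shellUnion_inter_closedBall_subset hA hN hη
    refine ⟨c + 3 ^ d, fun r hr => ?_⟩
    obtain ⟨F, hF, hcard⟩ := hc r hr
    refine ⟨(F ∪ integerCube d ⌊r⌋₊).image (WithLp.toLp 2), ?_, ?_⟩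
    · rintro x ⟨hx, hxr⟩
      have hxr' : ‖x.ofLp‖ ≤ r := (norm_ofLp_le x).trans (mem_closedBall_zero_iff.1 hxr)
      refine Finset.mem_coe.2 (Finset.mem_image.2 ⟨x.ofLp, Finset.mem_union.2 ?_, rfl⟩)
      rcases hx with hx | ⟨m, hm⟩
      · exact Or.inl (hF ⟨hx, mem_closedBall_zero_iff.2 hxr'⟩)
      · rw [← hm] at hxr' ⊢
        exact Or.inr (mem_integerCube_floor hxr')
    · have h1 : ((integerCube d ⌊r⌋₊).card : ℝ) ≤ 3 ^ d * r ^ ((d : ℝ) + 2 * η) := by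
        have h2 : (2 * (⌊r⌋₊ : ℝ) + 1) ≤ 3 * r := by
          linarith [Nat.floor_le (show 0 ≤ r by linarith)]
        have h3 : r ^ (d : ℝ) ≤ r ^ ((d : ℝ) + 2 * η) :=
          Real.rpow_le_rpow_of_exponent_le hr (by linarith)
        rw [Real.rpow_natCast] at h3
        rw [card_integerCube]
        push_cast
        calc (2 * (⌊r⌋₊ : ℝ) + 1) ^ d ≤ (3 * r) ^ d := by gcongr
          _ = 3 ^ d * r ^ d := mul_pow _ _ _
          _ ≤ _ := by gcongr
      have h4 : (((F ∪ integerCube d ⌊r⌋₊).image (WithLp.toLp 2)).card : ℝ) ≤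
          F.card + (integerCube d ⌊r⌋₊).card := by
        exact_mod_cast Finset.card_image_le.trans (Finset.card_union_le _ _)
      linarith
  refine ⟨{x | x.ofLp ∈ shellUnion N ∪ Z}, ⟨v, hv,
    isUniversalConvexCoveringWith_preimage_ofLp fun C hC hvol =>
      (hhit C hC hvol).mono (Set.inter_subset_inter_right _ Set.subset_union_left)⟩,
    isNearlyUniform_of_ncard_bounds hd ⟨0, Or.inr ⟨0, by ext i; simp⟩⟩ (fun r hr => ?_)
      -- The Euclidean norm is at most `d` times the supremum norm.
      (c := d) (fun r hr => ?_) fun e he => ?_⟩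
  · obtain ⟨c, hc⟩ := hcover 1 one_pos
    obtain ⟨F, hF, -⟩ := hc r hr
    exact F.finite_toSet.subset hF
  · obtain ⟨c, hc⟩ := hcover 1 one_pos
    have hdr : 1 ≤ d * r := one_le_mul_of_one_le_of_one_le (by exact_mod_cast hd) hr
    obtain ⟨F, hF, -⟩ := hc _ hdr
    have hsub : (((integerCube d ⌊r⌋₊).image (WithLp.toLp 2) :
        Finset (EuclideanSpace ℝ (Fin d))) : Set (EuclideanSpace ℝ (Fin d))) ⊆
        {x | x.ofLp ∈ shellUnion N ∪ Z} ∩ Metric.closedBall 0 (d * r) := fun y hy => by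
      obtain ⟨x, hx, rfl⟩ := Finset.mem_image.1 (Finset.mem_coe.1 hy)
      have hxn := (norm_le_of_mem_integerCube hx).trans (Nat.floor_le (by linarith))
      obtain ⟨m, -, hm⟩ := Finset.mem_map.1 hx
      refine ⟨Or.inr ⟨m, hm⟩, mem_closedBall_zero_iff.2 ((norm_toLp_le_mul_norm x).trans ?_)⟩
      gcongr
    have h1 := Set.ncard_le_ncard hsub (F.finite_toSet.subset hF)
    rw [Set.ncard_coe_finset, Finset.card_image_of_injective _ (WithLp.toLp_injective 2),
      card_integerCube] at h1
    calc r ^ d ≤ (2 * (⌊r⌋₊ : ℝ) + 1) ^ d := by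
          have := (Nat.lt_floor_add_one r).le
          have h0 : (0 : ℝ) ≤ ⌊r⌋₊ := Nat.cast_nonneg _
          exact pow_le_pow_left₀ (by linarith) (by linarith) d
      _ ≤ _ := by exact_mod_cast h1
  · obtain ⟨c, hc⟩ := hcover ((e - d) / 2) (by linarith)
    refine ⟨c, fun r hr => ?_⟩
    obtain ⟨F, hF, hcard⟩ := hc r hr
    rw [show (d : ℝ) + 2 * ((e - d) / 2) = e by ring] at hcard
    refine le_trans (Nat.cast_le.2 ?_) hcard
    rw [← Set.ncard_coe_finset F]
    exact Set.ncard_le_ncard hF F.finite_toSet
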